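/- Let $l_1,l_2$ be real numbers with $0<l_2\le l_1$. For a nondegenerate triangle $ABC$ in the Euclidean plane let $a=BC$, $b=CA$, $c=AB$, and let $l_a$, $l_b$ be the lengths of the (internal) bisectors of the angles at $A$ and $B$, measured from the vertex to the opposite side. Put $$B_{\max}=2\arctan\frac{l_2}{l_1},\qquad A_{\max}=\pi-B_{\max},$$ $$c^{*}=\tfrac12\left(l_1+l_2+\sqrt{l_1^2+l_2^2-l_1l_2}\right),\qquad c^{**}=\tfrac12\sqrt{l_1^2+l_2^2},$$ $$a^{*}=\frac{c^{*}}{2c^{*}/l_1-1},\qquad b^{*}=\frac{c^{*}}{2c^{*}/l_2-1}.$$ Then, among the triangles with $l_a=l_2$ and $l_b=l_1$, the following hold, where uniqueness is up to congruence respecting the labels of the vertices. 1. For a real number $\alpha$, if $0<\alpha<A_{\max}$ there is a unique such triangle with $\angle A=\alpha$; otherwise there is none. 2. For a real number $\beta$, if $0<\beta<B_{\max}$ there is a unique such triangle with $\angle B=\beta$; otherwise there is none. 3. For a real number $\gamma$, if $0<\gamma<\pi$ there is a unique such triangle with $\angle C=\gamma$; otherwise there is none. 4. For a real number $x$, if $x>a^{*}$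 there is a unique such triangle with $a=x$; otherwise there is none. 5. For a real number $x$, if $x>b^{*}$ there is a unique such triangle with $b=x$; otherwise there is none. 6. For a real number $x$, if $c^{**}<x<c^{*}$ there is a unique such triangle with $c=x$; otherwise there is none. -/

import Mathlib

open EuclideanGeometry

noncomputable section

namespace TwoBisectors

/-- Nondegenerate triangles `ABC` in the Euclidean plane, with labelled vertices
`A = T.points 0`, `B = T.points 1`, `C = T.points 2`. -/
abbrev Tri : Type := Affine.Triangle ℝ (EuclideanSpace ℝ (Fin 2))

/-- The angle at the vertex `A`. -/
def angleA (T : Tri) : ℝ := ∠ (T.points 1) (T.points 0) (T.points 2)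

/-- The angle at the vertex `B`. -/
def angleB (T : Tri) : ℝ := ∠ (T.points 0) (T.points 1) (T.points 2)

/-- The angle at the vertex `C`. -/
def angleC (T : Tri) : ℝ := ∠ (T.points 0) (T.points 2) (T.points 1)

/-- The side `a = BC`. -/
def sideA (T : Tri) : ℝ := dist (T.points 1) (T.points 2)

/-- The side `b = CA`. -/
def sideB (T : Tri) : ℝ := dist (T.points 2) (T.points 0)

/-- The side `c = AB`. -/
def sideC (T : Tri) : ℝ := dist (T.points 0) (T.points 1)

/-- The bisector of the angle at `X` in the triangle `XYZ`, that is the segment `XL` with `L` on the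
side `YZ` and `∠ YXL = ∠ LXZ`, has length `l`. -/
def BisectorHasLength (X Y Z : EuclideanSpace ℝ (Fin 2)) (l : ℝ) : Prop :=
  ∃ L : EuclideanSpace ℝ (Fin 2), Sbtw ℝ Y L Z ∧ ∠ Y X L = ∠ L X Z ∧ dist X L = l

/-- The bisectors of the angles at `A` and at `B` have lengths `la` and `lb`. -/
def HasBisectors (T : Tri) (la lb : ℝ) : Prop :=
  BisectorHasLength (T.points 0) (T.points 1) (T.points 2) la ∧
    BisectorHasLength (T.points 1) (T.points 0) (T.points 2) lb

/-- If `x ∈ S` then there is a triangle with bisectors `la`, `lb` at `A`, `B` whose third element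
`elt` has the value `x`, and it is unique up to congruence (respecting the labels of the vertices);
if `x ∉ S` then there is no such triangle. -/
def UniqueExactlyOn (la lb : ℝ) (elt : Tri → ℝ) (S : Set ℝ) : Prop :=
  ∀ x : ℝ,
    (x ∈ S → ∃ T : Tri, (HasBisectors T la lb ∧ elt T = x) ∧
      ∀ T' : Tri, HasBisectors T' la lb ∧ elt T' = x → Congruent T'.points T.points) ∧
    (x ∉ S → ¬ ∃ T : Tri, HasBisectors T la lb ∧ elt T = x)

/-- The limiting value of the angle `B`. -/
def maxB (l₁ l₂ : ℝ) : ℝ := 2 * Real.arctan (l₂ / l₁)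

/-- The limiting value of the angle `A`. -/
def maxA (l₁ l₂ : ℝ) : ℝ := Real.pi - maxB l₁ l₂

/-- `c^*`, the upper limiting value of the side `c`. -/
def cStar (l₁ l₂ : ℝ) : ℝ := (l₁ + l₂ + Real.sqrt (l₁ ^ 2 + l₂ ^ 2 - l₁ * l₂)) / 2

/-- `a^*`, the lower limiting value of the side `a`. -/
def aStar (l₁ l₂ : ℝ) : ℝ := cStar l₁ l₂ / (cStar l₁ l₂ * (2 / l₁) - 1)

/-- `b^*`, the lower limiting value of the side `b`. -/
def bStar (l₁ l₂ : ℝ) : ℝ := cStar l₁ l₂ / (cStar l₁ l₂ * (2 / l₂) - 1)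

/-- `c^{**}`, the lower limiting value of the side `c`. -/
def cStarStar (l₁ l₂ : ℝ) : ℝ := Real.sqrt (l₁ ^ 2 + l₂ ^ 2) / 2

end TwoBisectors

end

/-! Let `α`, `β` be the half-angles at `A`, `B`. The law of sines in the two triangles cut off by
the bisectors turns the bisector conditions into `c sin 2α = l₁ sin (2α + β)` and `c sin 2β = l₂ sin
(2β + α)`. Eliminating `c` leaves `bisectorRatio α β = l₁ / l₂`. This ratio strictly increases in
`α` and strictly decreases in `β`, so on the level curve both half-angles increase together, and `s
= α + β` in `(0, π/2)` parametrizes all the triangles.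

Along this curve every element is strictly monotone in `s` (`IsConfig.side_lt`,
`IsConfig.oppositeSide_lt`) and continuous. Its values therefore fill exactly the open interval
between its limits at `0` and `π/2`, each value being taken once.

As `s → 0`, with `r = tan β / tan α`, the side `c` is close to both `l₁ (1 + r/2)` and `l₂ (1 +
1/(2r))`. Eliminating `r` gives `4 (c - l₁)(c - l₂) = l₁ l₂`, whose larger root is `c*`. As `s →
π/2` the angle `C` vanishes, `tan α → l₁ / l₂`, and the sides `a`, `b` become infinite. The identity
`1/a + 1/c = 2 cos β / l₁` transfers the behaviour of `c` to `a`, and symmetrically to `b`. -/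

namespace TwoBisectors

/-! ### Angle bisectors and polar coordinates -/

section Geometry

variable {V P : Type*} [NormedAddCommGroup V] [InnerProductSpace ℝ V] [MetricSpace P]
  [NormedAddTorsor V P]

/-- The foot of the bisector divides the opposite side in the ratio of the adjacent sides. -/
theorem exists_sbtw_angle_eq {X Y Z : P} (h : ¬ Collinear ℝ {X, Y, Z}) :
    ∃ L : P, Sbtw ℝ Y L Z ∧ ∠ Y X L = ∠ L X Z := by
  have hXY : X ≠ Y := ne₁₂_of_not_collinear h
  have hXZ : X ≠ Z := ne₁₃_of_not_collinear h
  have hYZ : Y ≠ Z := ne₂₃_of_not_collinear h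
  have hc : 0 < ‖Y -ᵥ X‖ := norm_pos_iff.2 (vsub_ne_zero.2 hXY.symm)
  have hb : 0 < ‖Z -ᵥ X‖ := norm_pos_iff.2 (vsub_ne_zero.2 hXZ.symm)
  set y := Y -ᵥ X with hy
  set z := Z -ᵥ X with hz
  set t := ‖y‖ / (‖z‖ + ‖y‖) with ht
  -- The vectors `‖z‖ • y` and `‖y‖ • z` have equal length, so their sum bisects the angle between
  -- `y` and `z`.
  have hL : AffineMap.lineMap Y Z t -ᵥ X = (‖z‖ + ‖y‖)⁻¹ • (‖z‖ • y + ‖y‖ • z) := by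
    have hYZ' : Z -ᵥ Y = z - y := by rw [hy, hz, vsub_sub_vsub_cancel_right]
    rw [AffineMap.lineMap_apply, vadd_vsub_assoc, hYZ', ← hy, smul_add, smul_smul, smul_smul,
      smul_sub, ht, div_eq_inv_mul]
    have : (‖z‖ + ‖y‖)⁻¹ * ‖z‖ = 1 - (‖z‖ + ‖y‖)⁻¹ * ‖y‖ := by field_simp; ring
    rw [this, sub_smul, one_smul]
    abel
  refine ⟨AffineMap.lineMap Y Z t, ?_, ?_⟩
  · rw [sbtw_lineMap_iff]
    refine ⟨hYZ, by positivity, ?_⟩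
    rw [ht, div_lt_one (by positivity)]
    linarith
  · have hpos : 0 < (‖z‖ + ‖y‖)⁻¹ := by positivity
    unfold EuclideanGeometry.angle
    rw [hL, ← hy, ← hz, InnerProductGeometry.angle_smul_right_of_pos _ _ hpos,
      InnerProductGeometry.angle_smul_left_of_pos _ _ hpos, InnerProductGeometry.angle,
      InnerProductGeometry.angle]
    congr 1
    rw [inner_add_right, inner_add_left, real_inner_smul_right, real_inner_smul_right,
      real_inner_smul_left, real_inner_smul_left, real_inner_self_eq_norm_sq,
      real_inner_self_eq_norm_sq, mul_comm (‖‖z‖ • y + ‖y‖ • z‖), ← div_div, ← div_div]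
    congr 1
    field_simp
    ring

/-- Law of sines in the triangle `XYL`, whose angle at `L` is `π - X/2 - Y`. -/
theorem dist_mul_sin_eq_of_angle_eq {X Y Z L : P} (h : ¬ Collinear ℝ {X, Y, Z})
    (hL : Sbtw ℝ Y L Z) (hang : ∠ Y X L = ∠ L X Z) :
    dist X Y * Real.sin (∠ X Y Z) = dist X L * Real.sin (∠ Y X Z / 2 + ∠ X Y Z) := by
  have hXY : X ≠ Y := ne₁₂_of_not_collinear h
  have hadd := angle_add_of_ne_of_ne hXY (ne₁₃_of_not_collinear h) hL.wbtw
  have hY : ∠ X Y L = ∠ X Y Z := hL.angle_eq_right X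
  have hsum := angle_add_angle_add_angle_eq_pi L hXY.symm
  have hsin := sin_angle_mul_dist_eq_sin_angle_mul_dist L Y X
  have : ∠ Y X Z / 2 + ∠ X Y Z = Real.pi - ∠ Y L X := by
    rw [angle_comm L X Y] at hsum
    linarith
  rw [this, Real.sin_pi_sub, ← hY]
  rw [angle_comm L Y X, angle_comm X L Y, dist_comm Y X] at hsin
  linarith

theorem bisectorHasLength_iff {X Y Z : EuclideanSpace ℝ (Fin 2)} (h : ¬ Collinear ℝ {X, Y, Z})
    (l : ℝ) : BisectorHasLength X Y Z l ↔
      dist X Y * Real.sin (∠ X Y Z) = l * Real.sin (∠ Y X Z / 2 + ∠ X Y Z) := by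
  constructor
  · rintro ⟨L, hL, hang, rfl⟩
    exact dist_mul_sin_eq_of_angle_eq h hL hang
  · intro hl
    obtain ⟨L, hL, hang⟩ := exists_sbtw_angle_eq h
    refine ⟨L, hL, hang, ?_⟩
    have := dist_mul_sin_eq_of_angle_eq h hL hang
    rw [hl] at this
    have hpos : 0 < Real.sin (∠ Y X Z / 2 + ∠ X Y Z) := by
      have hX : 0 < ∠ Y X Z := by
        apply angle_pos_of_not_collinear
        rwa [Set.insert_comm]
      have hY : 0 < ∠ X Y Z := angle_pos_of_not_collinear h
      have hZ := angle_nonneg Y Z X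
      have hsum := angle_add_angle_add_angle_eq_pi Z (ne₁₂_of_not_collinear h).symm
      rw [angle_comm Z X Y] at hsum
      exact Real.sin_pos_of_pos_of_lt_pi (by linarith) (by linarith)
    exact (mul_right_cancel₀ hpos.ne' this).symm

theorem angle_eq_of_inner_eq {u v : V} {θ : ℝ} (hu : u ≠ 0) (hv : v ≠ 0) (h0 : 0 ≤ θ)
    (hπ : θ ≤ Real.pi) (h : inner ℝ u v = ‖u‖ * ‖v‖ * Real.cos θ) :
    InnerProductGeometry.angle u v = θ := by
  have hu' := norm_ne_zero_iff.2 hu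
  have hv' := norm_ne_zero_iff.2 hv
  rw [InnerProductGeometry.angle, h, mul_div_cancel_left₀ _ (mul_ne_zero hu' hv'),
    Real.arccos_cos h0 hπ]

theorem norm_toLp_cos_sin {r : ℝ} (hr : 0 ≤ r) (θ : ℝ) :
    ‖(!₂[r * Real.cos θ, r * Real.sin θ] : EuclideanSpace ℝ (Fin 2))‖ = r := by
  rw [EuclideanSpace.norm_eq, Fin.sum_univ_two]
  have : ‖(!₂[r * Real.cos θ, r * Real.sin θ] : EuclideanSpace ℝ (Fin 2)) 0‖ ^ 2 +
      ‖(!₂[r * Real.cos θ, r * Real.sin θ] : EuclideanSpace ℝ (Fin 2)) 1‖ ^ 2 = r ^ 2 := by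
    simp only [Real.norm_eq_abs, sq_abs]
    simp
    linear_combination r ^ 2 * Real.sin_sq_add_cos_sq θ
  rw [this, Real.sqrt_sq hr]

theorem angle_toLp_cos_sin {r r' θ θ' : ℝ} (hr : 0 < r) (hr' : 0 < r') (h0 : 0 ≤ θ - θ')
    (hπ : θ - θ' ≤ Real.pi) :
    InnerProductGeometry.angle (!₂[r * Real.cos θ, r * Real.sin θ] : EuclideanSpace ℝ (Fin 2))
      !₂[r' * Real.cos θ', r' * Real.sin θ'] = θ - θ' := by
  have hn := norm_toLp_cos_sin hr.le θ
  have hn' := norm_toLp_cos_sin hr'.le θ'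
  refine angle_eq_of_inner_eq ?_ ?_ h0 hπ ?_
  · rw [← norm_pos_iff, hn]; exact hr
  · rw [← norm_pos_iff, hn']; exact hr'
  · rw [hn, hn', Real.cos_sub, PiLp.inner_apply, Fin.sum_univ_two]
    simp
    ring

end Geometry

/-! ### Triangles determined by two angles and the common side -/

section Triangles

theorem not_collinear_points (T : Tri) :
    ¬ Collinear ℝ {T.points 0, T.points 1, T.points 2} := by
  rw [← affineIndependent_iff_not_collinear_set]
  have h : ![T.points 0, T.points 1, T.points 2] = T.points := by
    funext i
    fin_cases i <;> rfl
  rw [h]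
  exact T.independent

theorem not_collinear_points_swap (T : Tri) :
    ¬ Collinear ℝ {T.points 1, T.points 0, T.points 2} := by
  rw [Set.insert_comm]
  exact not_collinear_points T

theorem angleA_pos (T : Tri) : 0 < angleA T :=
  angle_pos_of_not_collinear (not_collinear_points_swap T)

theorem angleB_pos (T : Tri) : 0 < angleB T :=
  angle_pos_of_not_collinear (not_collinear_points T)

theorem angleC_pos (T : Tri) : 0 < angleC T := by
  apply angle_pos_of_not_collinear
  rw [Set.pair_comm]
  exact not_collinear_points T

theorem angleA_add_angleB_add_angleC (T : Tri) :
    angleA T + angleB T + angleC T = Real.pi := by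
  have h := angle_add_angle_add_angle_eq_pi (T.points 2)
    (ne₁₂_of_not_collinear (not_collinear_points T)).symm
  rw [angle_comm (T.points 2), angle_comm (T.points 1) (T.points 2)] at h
  unfold angleA angleB angleC
  linarith

theorem sideA_mul_sin (T : Tri) :
    sideA T * Real.sin (angleA T + angleB T) = sideC T * Real.sin (angleA T) := by
  have h := sin_angle_mul_dist_eq_sin_angle_mul_dist (T.points 0) (T.points 2) (T.points 1)
  have hC : angleA T + angleB T = Real.pi - angleC T := by
    linarith [angleA_add_angleB_add_angleC T]
  rw [hC, Real.sin_pi_sub, sideA, sideC, angleA, angleC, dist_comm (T.points 1),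
    dist_comm (T.points 0)]
  linarith

theorem sideB_mul_sin (T : Tri) :
    sideB T * Real.sin (angleA T + angleB T) = sideC T * Real.sin (angleB T) := by
  have h := sin_angle_mul_dist_eq_sin_angle_mul_dist (T.points 1) (T.points 2) (T.points 0)
  have hC : angleA T + angleB T = Real.pi - angleC T := by
    linarith [angleA_add_angleB_add_angleC T]
  rw [angle_comm (T.points 1)] at h
  rw [hC, Real.sin_pi_sub, sideB, sideC, angleB, angleC]
  linarith

theorem congruent_of_angle_side_angle {T T' : Tri} (hA : angleA T = angleA T')
    (hc : sideC T = sideC T') (hB : angleB T = angleB T') : Congruent T.points T'.points := by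
  have h := angle_side_angle (a := T.points 2) (b := T.points 0) (c := T.points 1)
    (a' := T'.points 2) (b' := T'.points 0) (c' := T'.points 1) ?_ ?_ hc hB
  · rw [congruent_iff_dist_eq] at h
    refine triangle_congruent_iff_dist_eq.2 fun i j => ?_
    fin_cases i <;> fin_cases j
    -- The vertices were fed in the order `C, A, B`, so vertex `i` has index `i + 1` modulo 3 in
    -- `h`.
    exacts [h 1 1, h 1 2, h 1 0, h 2 1, h 2 2, h 2 0, h 0 1, h 0 2, h 0 0]
  · rw [Set.insert_comm, Set.pair_comm]
    exact not_collinear_points T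
  · rw [angle_comm, angle_comm (T'.points 2)]
    exact hA

theorem exists_triangle {A B c : ℝ} (hA : 0 < A) (hB : 0 < B) (hAB : A + B < Real.pi)
    (hc : 0 < c) : ∃ T : Tri, angleA T = A ∧ angleB T = B ∧ sideC T = c := by
  have hsA : 0 < Real.sin A := Real.sin_pos_of_pos_of_lt_pi hA (by linarith)
  have hsB : 0 < Real.sin B := Real.sin_pos_of_pos_of_lt_pi hB (by linarith)
  have hsC : 0 < Real.sin (A + B) := Real.sin_pos_of_pos_of_lt_pi (by linarith) hAB
  set b := c * Real.sin B / Real.sin (A + B) with hb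
  set a := c * Real.sin A / Real.sin (A + B) with ha
  have hbpos : 0 < b := by positivity
  have hapos : 0 < a := by positivity
  let X : EuclideanSpace ℝ (Fin 2) := 0
  let Y : EuclideanSpace ℝ (Fin 2) := !₂[c * Real.cos 0, c * Real.sin 0]
  let Z : EuclideanSpace ℝ (Fin 2) := !₂[b * Real.cos A, b * Real.sin A]
  have hYX : ‖Y‖ = c := norm_toLp_cos_sin hc.le 0
  have hZX : ‖Z‖ = b := norm_toLp_cos_sin hbpos.le A
  have hAang : ∠ Y X Z = A := by
    have := angle_toLp_cos_sin hbpos hc (θ := A) (θ' := 0) (by linarith) (by linarith)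
    rw [sub_zero] at this
    rw [angle_comm, EuclideanGeometry.angle]
    simpa [X, Y, Z] using this
  have hBang : ∠ X Y Z = B := by
    -- Seen from `Y = (c, 0)`, the points `X` and `Z` lie in the directions `π` and `π - B`; by the
    -- law of sines `Z` is at distance `a`.
    have := angle_toLp_cos_sin hc hapos (θ := Real.pi) (θ' := Real.pi - B) (by linarith)
      (by linarith)
    rw [sub_sub_cancel] at this
    rw [← this, EuclideanGeometry.angle]
    congr 1
    · ext i
      fin_cases i <;> simp [X, Y]
    · ext i
      have hs := Real.sin_add A B
      fin_cases i <;> simp [Y, Z, ha, hb] <;> field_simp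
      rw [hs]
      ring
  have hcol : ¬ Collinear ℝ {X, Y, Z} := by
    rw [Set.insert_comm, collinear_iff_eq_or_eq_or_sin_eq_zero, hAang]
    rintro (h | h | h)
    · rw [h] at hYX; simp [X] at hYX; linarith
    · rw [h] at hZX; simp [X] at hZX; linarith
    · linarith
  refine ⟨⟨![X, Y, Z], affineIndependent_iff_not_collinear_set.2 hcol⟩, hAang, hBang, ?_⟩
  change dist X Y = c
  rw [dist_comm, dist_eq_norm]
  simpa [X] using hYX

/-- The half-angles `α`, `β` and the side `c` of a triangle whose bisectors at `B` and `A` have the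
lengths `l₁` and `l₂`. -/
structure IsConfig (l₁ l₂ α β c : ℝ) : Prop where
  left_pos : 0 < α
  right_pos : 0 < β
  add_lt : α + β < Real.pi / 2
  left_eq : c * Real.sin (2 * α) = l₁ * Real.sin (2 * α + β)
  right_eq : c * Real.sin (2 * β) = l₂ * Real.sin (2 * β + α)

theorem hasBisectors_iff (T : Tri) (l₁ l₂ : ℝ) :
    HasBisectors T l₂ l₁ ↔ IsConfig l₁ l₂ (angleA T / 2) (angleB T / 2) (sideC T) := by
  have hC := angleC_pos T
  have hsum := angleA_add_angleB_add_angleC T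
  have h1 := bisectorHasLength_iff (not_collinear_points T) l₂
  have h2 := bisectorHasLength_iff (not_collinear_points_swap T) l₁
  rw [HasBisectors, h1, h2, dist_comm (T.points 1)]
  have hA2 : 2 * (angleA T / 2) = angleA T := by ring
  have hB2 : 2 * (angleB T / 2) = angleB T := by ring
  constructor
  · rintro ⟨h3, h4⟩
    refine ⟨half_pos (angleA_pos T), half_pos (angleB_pos T), by linarith, ?_, ?_⟩
    · rw [hA2, add_comm]; exact h4
    · rw [hB2, add_comm]; exact h3
  · rintro ⟨-, -, -, h4, h3⟩
    rw [hA2, add_comm] at h4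
    rw [hB2, add_comm] at h3
    exact ⟨h3, h4⟩

end Triangles

end TwoBisectors

namespace TwoBisectors

/-! ### Monotonicity of the bisector ratio -/

section Config

/-- For a triangle with half-angles `α` and `β`, the quotient of the bisectors at `B` and `A`. -/
noncomputable def bisectorRatio (α β : ℝ) : ℝ :=
  Real.sin (2 * α) * Real.sin (2 * β + α) / (Real.sin (2 * β) * Real.sin (2 * α + β))

theorem bisectorRatio_swap (α β : ℝ) : bisectorRatio β α = (bisectorRatio α β)⁻¹ :=
  (inv_div _ _).symm

theorem sin_two_mul_pos {α : ℝ} (hα : 0 < α) (h : α < Real.pi / 2) : 0 < Real.sin (2 * α) :=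
  Real.sin_pos_of_pos_of_lt_pi (by linarith) (by linarith)

theorem sin_two_mul_add_pos {α β : ℝ} (hα : 0 < α) (hβ : 0 < β) (h : α + β ≤ Real.pi / 2) :
    0 < Real.sin (2 * α + β) :=
  Real.sin_pos_of_pos_of_lt_pi (by linarith) (by linarith)

theorem bisectorRatio_pos {α β : ℝ} (hα : 0 < α) (hβ : 0 < β) (h : α + β ≤ Real.pi / 2) :
    0 < bisectorRatio α β := by
  have h1 := sin_two_mul_pos hα (by linarith)
  have h2 := sin_two_mul_pos hβ (by linarith)
  have h3 := sin_two_mul_add_pos hα hβ h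
  have h4 := sin_two_mul_add_pos hβ hα (by linarith)
  unfold bisectorRatio
  positivity

/-- Up to a positive factor, this is the derivative of `bisectorRatio` in `α`. Only `cos (2β + α) =
-x < 0` needs an argument. Then `sin² β - x cos α = cos² (α + β) ≥ 0` gives `x cos α ≤ sin² β < sin
β`, while `sin α ≤ sin (2β + α)`, so the first term dominates. -/
theorem bisectorRatio_deriv_num_pos {α β : ℝ} (hα : 0 < α) (hβ : 0 < β)
    (h : α + β ≤ Real.pi / 2) :
    0 < 2 * Real.sin (2 * β + α) * Real.sin β +
      Real.sin (2 * α) * Real.cos (2 * β + α) * Real.sin (2 * α + β) := by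
  have h1 := sin_two_mul_pos hα (by linarith)
  have h3 := sin_two_mul_add_pos hα hβ h
  have h4 := sin_two_mul_add_pos hβ hα (by linarith)
  have hsα : 0 < Real.sin α := Real.sin_pos_of_pos_of_lt_pi hα (by linarith)
  have hsβ : 0 < Real.sin β := Real.sin_pos_of_pos_of_lt_pi hβ (by linarith)
  rcases le_or_gt 0 (Real.cos (2 * β + α)) with hc | hc
  · positivity
  have hsβ1 : Real.sin β < 1 := by
    have := Real.sin_lt_sin_of_lt_of_le_pi_div_two (x := β) (y := Real.pi / 2)
      (by linarith) le_rfl (by linarith)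
    rwa [Real.sin_pi_div_two] at this
  have hcs : 0 ≤ Real.cos (α + β) := Real.cos_nonneg_of_mem_Icc ⟨by linarith, h⟩
  have hcα : 0 < Real.cos α := Real.cos_pos_of_mem_Ioo ⟨by linarith, by linarith⟩
  have hge : Real.sin α ≤ Real.sin (2 * β + α) := by
    have : Real.sin (2 * β + α) - Real.sin α = 2 * Real.sin β * Real.cos (α + β) := by
      rw [Real.sin_sub_sin]
      ring_nf
    nlinarith [mul_nonneg hsβ.le hcs]
  have hprod : Real.sin β ^ 2 + Real.cos α * Real.cos (2 * β + α) = Real.cos (α + β) ^ 2 := by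
    have e : 2 * β + α = β + (α + β) := by ring
    have e' : Real.cos α = Real.cos (α + β) * Real.cos β + Real.sin (α + β) * Real.sin β := by
      rw [← Real.cos_sub]; congr 1; ring
    rw [e, Real.cos_add β, e']
    linear_combination (Real.cos (α + β) ^ 2) * Real.sin_sq_add_cos_sq β -
      Real.sin β ^ 2 * Real.sin_sq_add_cos_sq (α + β)
  set x := -Real.cos (2 * β + α) with hx
  have hx0 : 0 < x := by linarith
  have hbound : Real.cos α * x ≤ Real.sin β ^ 2 := by nlinarith [sq_nonneg (Real.cos (α + β))]
  have hlt : Real.cos α * x * Real.sin (2 * α + β) < Real.sin β :=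
    calc Real.cos α * x * Real.sin (2 * α + β) ≤ Real.cos α * x * 1 := by
          gcongr; exact Real.sin_le_one _
      _ ≤ Real.sin β ^ 2 := by linarith
      _ < Real.sin β := by nlinarith
  have e1 : Real.cos (2 * β + α) = -x := by rw [hx]; ring
  rw [Real.sin_two_mul, e1]
  nlinarith [mul_lt_mul_of_pos_left hlt hsα, mul_le_mul_of_nonneg_right hge hsβ.le]

theorem strictMonoOn_bisectorRatio {β : ℝ} (hβ : 0 < β) :
    StrictMonoOn (fun α => bisectorRatio α β) (Set.Ioc 0 (Real.pi / 2 - β)) := by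
  have hden : ∀ α ∈ Set.Ioc 0 (Real.pi / 2 - β),
      Real.sin (2 * β) * Real.sin (2 * α + β) ≠ 0 := fun α hα =>
    (mul_pos (sin_two_mul_pos hβ (by linarith [hα.1, hα.2]))
      (sin_two_mul_add_pos hα.1 hβ (by linarith [hα.2]))).ne'
  have hderiv : ∀ α ∈ Set.Ioc 0 (Real.pi / 2 - β), HasDerivAt (fun α => bisectorRatio α β)
      (((2 * Real.cos (2 * α) * Real.sin (2 * β + α) + Real.sin (2 * α) * Real.cos (2 * β + α)) *
        (Real.sin (2 * β) * Real.sin (2 * α + β)) - Real.sin (2 * α) * Real.sin (2 * β + α) *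
        (Real.sin (2 * β) * (2 * Real.cos (2 * α + β)))) /
        (Real.sin (2 * β) * Real.sin (2 * α + β)) ^ 2) α := by
    intro α hα
    have d1 : HasDerivAt (fun α : ℝ => Real.sin (2 * α)) (2 * Real.cos (2 * α)) α := by
      simpa [mul_comm] using ((hasDerivAt_id α).const_mul 2).sin
    have d2 : HasDerivAt (fun α : ℝ => Real.sin (2 * β + α)) (Real.cos (2 * β + α)) α := by
      simpa using ((hasDerivAt_id α).const_add (2 * β)).sin
    have d3 : HasDerivAt (fun α : ℝ => Real.sin (2 * α + β)) (2 * Real.cos (2 * α + β)) α := by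
      simpa [mul_comm] using (((hasDerivAt_id α).const_mul 2).add_const β).sin
    exact (d1.mul d2).div (d3.const_mul (Real.sin (2 * β))) (hden α hα)
  refine strictMonoOn_of_deriv_pos (convex_Ioc _ _)
    (fun α hα => (hderiv α hα).continuousAt.continuousWithinAt) ?_
  intro α hα
  rw [interior_Ioc] at hα
  have hα' : α ∈ Set.Ioc 0 (Real.pi / 2 - β) := ⟨hα.1, hα.2.le⟩
  rw [(hderiv α hα').deriv]
  have h2 := sin_two_mul_pos hβ (by linarith [hα.1, hα.2])
  have hnum := bisectorRatio_deriv_num_pos hα.1 hβ (by linarith [hα.2])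
  refine div_pos ?_ (by have := hden α hα'; positivity)
  have e : Real.sin β = Real.sin (2 * α + β) * Real.cos (2 * α) -
      Real.cos (2 * α + β) * Real.sin (2 * α) := by
    rw [← Real.sin_sub]; congr 1; ring
  rw [e] at hnum
  nlinarith [mul_pos h2 hnum]

theorem strictAntiOn_bisectorRatio {α : ℝ} (hα : 0 < α) :
    StrictAntiOn (bisectorRatio α) (Set.Ioc 0 (Real.pi / 2 - α)) := by
  intro β hβ β' hβ' hlt
  have h := strictMonoOn_bisectorRatio hα hβ hβ' hlt
  simp only [bisectorRatio_swap α] at h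
  exact (inv_lt_inv₀ (bisectorRatio_pos hα hβ.1 (by linarith [hβ.2]))
    (bisectorRatio_pos hα hβ'.1 (by linarith [hβ'.2]))).1 h

/-- The boundary value where the angle `C` vanishes. As the ratio decreases in `β`, it bounds `tan
α` by `l₁ / l₂`. -/
theorem bisectorRatio_of_add_eq {α : ℝ} (hα : 0 < α) (h : α < Real.pi / 2) :
    bisectorRatio α (Real.pi / 2 - α) = Real.tan α := by
  have h1 := sin_two_mul_pos hα h
  have e1 : 2 * (Real.pi / 2 - α) + α = Real.pi - α := by ring
  have e2 : 2 * (Real.pi / 2 - α) = Real.pi - 2 * α := by ring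
  have e3 : 2 * α + (Real.pi / 2 - α) = α + Real.pi / 2 := by ring
  rw [bisectorRatio, e1, e2, e3, Real.sin_pi_sub, Real.sin_pi_sub, Real.sin_add_pi_div_two,
    mul_div_mul_left _ _ h1.ne', Real.tan_eq_sin_div_cos]

/-! ### Comparing and bounding solutions of the bisector equations -/

variable {l₁ l₂ α β c α' β' c' : ℝ}

namespace IsConfig

theorem symm (h : IsConfig l₁ l₂ α β c) : IsConfig l₂ l₁ β α c :=
  ⟨h.right_pos, h.left_pos, by linarith [h.add_lt], h.right_eq, h.left_eq⟩

theorem left_lt (h : IsConfig l₁ l₂ α β c) : α < Real.pi / 2 := by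
  linarith [h.right_pos, h.add_lt]

theorem sin_left_pos (h : IsConfig l₁ l₂ α β c) : 0 < Real.sin (2 * α) :=
  sin_two_mul_pos h.left_pos h.left_lt

theorem sin_add_pos (h : IsConfig l₁ l₂ α β c) : 0 < Real.sin (2 * α + β) :=
  sin_two_mul_add_pos h.left_pos h.right_pos h.add_lt.le

theorem side_eq (h : IsConfig l₁ l₂ α β c) :
    c = l₁ * Real.sin (2 * α + β) / Real.sin (2 * α) := by
  rw [eq_div_iff h.sin_left_pos.ne', h.left_eq]

theorem side_pos (h : IsConfig l₁ l₂ α β c) (hl₁ : 0 < l₁) : 0 < c := by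
  have h1 := h.sin_left_pos
  have h2 := h.sin_add_pos
  rw [h.side_eq]
  positivity

theorem bisectorRatio_eq (h : IsConfig l₁ l₂ α β c) (hl₁ : 0 < l₁) (hl₂ : 0 < l₂) :
    bisectorRatio α β = l₁ / l₂ := by
  have h1 := h.sin_left_pos
  have h2 := h.sin_add_pos
  have h3 := h.symm.sin_left_pos
  have hc := h.side_pos hl₁
  rw [bisectorRatio, div_eq_div_iff (by positivity) hl₂.ne']
  apply mul_left_cancel₀ hc.ne'
  linear_combination (-c * Real.sin (2 * α)) * h.right_eq +
    (c * Real.sin (2 * β)) * h.left_eq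

theorem tan_lt (h : IsConfig l₁ l₂ α β c) (hl₁ : 0 < l₁) (hl₂ : 0 < l₂) :
    Real.tan α < l₁ / l₂ := by
  rw [← h.bisectorRatio_eq hl₁ hl₂, ← bisectorRatio_of_add_eq h.left_pos h.left_lt]
  have := h.add_lt
  exact strictAntiOn_bisectorRatio h.left_pos ⟨h.right_pos, by linarith⟩
    ⟨by linarith [h.left_lt], le_rfl⟩ (by linarith)

theorem left_lt_arctan (h : IsConfig l₁ l₂ α β c) (hl₁ : 0 < l₁) (hl₂ : 0 < l₂) :
    α < Real.arctan (l₁ / l₂) := by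
  rw [← Real.arctan_tan (by linarith [h.left_pos, Real.pi_pos]) h.left_lt]
  exact Real.arctan_strictMono (h.tan_lt hl₁ hl₂)

/-- Along the family of triangles with given bisectors both half-angles vary in the same sense. -/
theorem eq_of_le_of_le (h : IsConfig l₁ l₂ α β c) (h' : IsConfig l₁ l₂ α' β' c') (hl₁ : 0 < l₁)
    (hl₂ : 0 < l₂) (hα : α ≤ α') (hβ : β' ≤ β) : α = α' ∧ β = β' := by
  have e := h.bisectorRatio_eq hl₁ hl₂
  have e' := h'.bisectorRatio_eq hl₁ hl₂
  have hs := h.add_lt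
  have hs' := h'.add_lt
  -- The comparison passes through `(α, β')`, which is admissible because `α + β' ≤ α + β`.
  have m1 : β' ∈ Set.Ioc 0 (Real.pi / 2 - α) := ⟨h'.right_pos, by linarith⟩
  have m2 : β ∈ Set.Ioc 0 (Real.pi / 2 - α) := ⟨h.right_pos, by linarith⟩
  have m3 : α ∈ Set.Ioc 0 (Real.pi / 2 - β') := ⟨h.left_pos, by linarith⟩
  have m4 : α' ∈ Set.Ioc 0 (Real.pi / 2 - β') := ⟨h'.left_pos, by linarith⟩
  have hanti := strictAntiOn_bisectorRatio h.left_pos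
  have hmono := strictMonoOn_bisectorRatio h'.right_pos
  have i1 : bisectorRatio α β ≤ bisectorRatio α β' := hanti.antitoneOn m1 m2 hβ
  have i2 : bisectorRatio α β' ≤ bisectorRatio α' β' := hmono.monotoneOn m3 m4 hα
  constructor
  · refine hα.eq_or_lt.resolve_right fun hlt => ?_
    have : bisectorRatio α β' < bisectorRatio α' β' := hmono m3 m4 hlt
    linarith
  · refine (hβ.eq_or_lt.resolve_right fun hlt => ?_).symm
    have : bisectorRatio α β < bisectorRatio α β' := hanti m1 m2 hlt
    linarith

theorem tan_pos (h : IsConfig l₁ l₂ α β c) : 0 < Real.tan α :=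
  Real.tan_pos_of_pos_of_lt_pi_div_two h.left_pos h.left_lt

theorem cos_pos (h : IsConfig l₁ l₂ α β c) : 0 < Real.cos α :=
  Real.cos_pos_of_mem_Ioo ⟨by linarith [h.left_pos, Real.pi_pos], h.left_lt⟩

theorem sin_pos (h : IsConfig l₁ l₂ α β c) : 0 < Real.sin α :=
  Real.sin_pos_of_pos_of_lt_pi h.left_pos (by linarith [h.left_lt, Real.pi_pos])

/-- As the half-angles grow, `cos β` and `-tan β tan α` decrease; only `tan β / tan α` has no
evident direction. -/
theorem side_eq_tan (h : IsConfig l₁ l₂ α β c) :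
    c = l₁ * (Real.cos β *
      (1 + (Real.tan β / Real.tan α - Real.tan β * Real.tan α) / 2)) := by
  have h1 := h.sin_pos
  have h2 := h.cos_pos
  have h3 := h.symm.cos_pos
  rw [h.side_eq, Real.sin_add, Real.sin_two_mul, Real.cos_two_mul', Real.tan_eq_sin_div_cos,
    Real.tan_eq_sin_div_cos]
  field_simp

theorem side_lt_of_tan_div_le (h : IsConfig l₁ l₂ α β c) (h' : IsConfig l₁ l₂ α' β' c')
    (hl₁ : 0 < l₁) (hα : α < α') (hβ : β < β')
    (hle : Real.tan β' / Real.tan α' ≤ Real.tan β / Real.tan α) : c' < c := by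
  have hc' := h'.side_pos hl₁
  have e := h.side_eq_tan
  have e' := h'.side_eq_tan
  have hp := h.tan_pos
  have hq := h.symm.tan_pos
  have hp' : Real.tan α < Real.tan α' :=
    Real.tan_lt_tan_of_nonneg_of_lt_pi_div_two h.left_pos.le h'.left_lt hα
  have hq' : Real.tan β < Real.tan β' :=
    Real.tan_lt_tan_of_nonneg_of_lt_pi_div_two h.right_pos.le h'.symm.left_lt hβ
  have hcos : Real.cos β' < Real.cos β :=
    Real.cos_lt_cos_of_nonneg_of_le_pi_div_two h.right_pos.le h'.symm.left_lt.le hβ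
  have hmul : Real.tan β * Real.tan α < Real.tan β' * Real.tan α' := by gcongr
  rw [e, e']
  have hpos : 0 < 1 + (Real.tan β' / Real.tan α' - Real.tan β' * Real.tan α') / 2 := by
    rw [e'] at hc'
    have h1 := (mul_pos_iff_of_pos_left hl₁).1 hc'
    exact (mul_pos_iff_of_pos_left h'.symm.cos_pos).1 h1
  have hcβ' := h'.symm.cos_pos
  gcongr ?_ * ?_
  exact mul_lt_mul'' hcos (by linarith) hcβ'.le hpos.le

/-- The common side decreases as the half-angles increase. -/
theorem side_lt (h : IsConfig l₁ l₂ α β c) (h' : IsConfig l₁ l₂ α' β' c') (hl₁ : 0 < l₁)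
    (hl₂ : 0 < l₂) (hα : α < α') (hβ : β < β') : c' < c := by
  -- Either `tan β / tan α` or its inverse does not increase; in the second case the formula with
  -- the roles of `A` and `B` exchanged applies.
  rcases le_total (Real.tan β' / Real.tan α') (Real.tan β / Real.tan α) with hle | hle
  · exact h.side_lt_of_tan_div_le h' hl₁ hα hβ hle
  · refine h.symm.side_lt_of_tan_div_le h'.symm hl₂ hβ hα ?_
    rw [← inv_div (Real.tan β'), ← inv_div (Real.tan β)]
    have := h.tan_pos
    have := h.symm.tan_pos
    exact inv_anti₀ (by positivity) hle

theorem side_lt_mul (h : IsConfig l₁ l₂ α β c) (hl₁ : 0 < l₁) :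
    c < l₁ * (1 + Real.tan β / Real.tan α / 2) := by
  have hp := h.tan_pos
  have hq := h.symm.tan_pos
  have hc := h.symm.cos_pos
  have hr : 0 < Real.tan β / Real.tan α := by positivity
  have hpq : 0 < Real.tan β * Real.tan α := by positivity
  rw [h.side_eq_tan]
  gcongr
  nlinarith [Real.cos_le_one β]

/-- The factors `cos β` and `1 - tan² α` that separate `c` from the bound of `side_lt_mul` are both
at least `cos (2 (α + β))`. -/
theorem mul_le_side (h : IsConfig l₁ l₂ α β c) (hl₁ : 0 < l₁) (hs : α + β ≤ Real.pi / 4) :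
    Real.cos (2 * (α + β)) ^ 2 * (l₁ * (1 + Real.tan β / Real.tan α / 2)) ≤ c := by
  have hα := h.left_pos
  have hβ := h.right_pos
  have hp := h.tan_pos
  have hq := h.symm.tan_pos
  have hcβ := h.symm.cos_pos
  have hcα := h.cos_pos
  have hr : 0 < Real.tan β / Real.tan α := by positivity
  have hk : 0 ≤ Real.cos (2 * (α + β)) :=
    Real.cos_nonneg_of_mem_Icc ⟨by linarith [Real.pi_pos], by linarith⟩
  have k1 : Real.cos (2 * (α + β)) ≤ Real.cos β :=
    Real.cos_le_cos_of_nonneg_of_le_pi hβ.le (by linarith [Real.pi_pos]) (by linarith)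
  have k2 : Real.cos (2 * (α + β)) ≤ Real.cos (2 * α) :=
    Real.cos_le_cos_of_nonneg_of_le_pi (by linarith) (by linarith [Real.pi_pos]) (by linarith)
  have k3 : Real.cos (2 * α) ≤ 1 - Real.tan α ^ 2 := by
    have e : Real.cos (2 * α) = Real.cos α ^ 2 * (1 - Real.tan α ^ 2) := by
      rw [Real.cos_two_mul', Real.tan_eq_sin_div_cos]
      field_simp
    have h0 : 0 ≤ 1 - Real.tan α ^ 2 := by
      have : 0 ≤ Real.cos α ^ 2 * (1 - Real.tan α ^ 2) := by linarith
      exact (mul_nonneg_iff_of_pos_left (by positivity)).1 this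
    rw [e]
    nlinarith [Real.cos_sq_le_one α]
  have e : Real.tan β * Real.tan α = Real.tan β / Real.tan α * Real.tan α ^ 2 := by
    field_simp
  rw [h.side_eq_tan, e]
  have : Real.cos (2 * (α + β)) ^ 2 * (1 + Real.tan β / Real.tan α / 2) ≤ Real.cos β *
      (1 + (Real.tan β / Real.tan α - Real.tan β / Real.tan α * Real.tan α ^ 2) / 2) := by
    rw [sq, mul_assoc]
    refine mul_le_mul k1 ?_ (by positivity) hcβ.le
    nlinarith [Real.cos_le_one (2 * (α + β)), sq_nonneg (Real.tan α)]
  nlinarith [mul_le_mul_of_nonneg_left this hl₁.le]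

end IsConfig

/-! ### The limiting value of the common side -/

theorem cStar_comm (l₁ l₂ : ℝ) : cStar l₁ l₂ = cStar l₂ l₁ := by
  unfold cStar
  rw [show l₂ ^ 2 + l₁ ^ 2 - l₂ * l₁ = l₁ ^ 2 + l₂ ^ 2 - l₁ * l₂ by ring, add_comm l₁]

theorem cStar_mul (l₁ l₂ : ℝ) :
    4 * ((cStar l₁ l₂ - l₁) * (cStar l₁ l₂ - l₂)) = l₁ * l₂ := by
  have h : Real.sqrt (l₁ ^ 2 + l₂ ^ 2 - l₁ * l₂) ^ 2 = l₁ ^ 2 + l₂ ^ 2 - l₁ * l₂ :=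
    Real.sq_sqrt (by nlinarith [sq_nonneg (l₁ - l₂), sq_nonneg (l₁ + l₂)])
  unfold cStar
  linear_combination h

theorem lt_cStar (hl₁ : 0 < l₁) (hl₂ : 0 < l₂) : l₁ < cStar l₁ l₂ := by
  have h : l₁ - l₂ < Real.sqrt (l₁ ^ 2 + l₂ ^ 2 - l₁ * l₂) :=
    Real.lt_sqrt_of_sq_lt (by nlinarith [mul_pos hl₁ hl₂])
  unfold cStar
  linarith

/-- Multiplying the two upper bounds for `c - l₁` and `c - l₂` cancels `tan β / tan α` and leaves
`l₁ l₂ / 4`, the value of the same product at `c*`. -/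
theorem IsConfig.lt_cStar (h : IsConfig l₁ l₂ α β c) (hl₁ : 0 < l₁) (hl₂ : 0 < l₂) :
    c < cStar l₁ l₂ := by
  by_contra! hle
  have hp := h.tan_pos
  have hq := h.symm.tan_pos
  have g1 := TwoBisectors.lt_cStar hl₁ hl₂
  have g2 := TwoBisectors.lt_cStar hl₂ hl₁
  rw [cStar_comm] at g2
  have u1 := h.side_lt_mul hl₁
  have u2 := h.symm.side_lt_mul hl₂
  have m1 : (c - l₁) * (c - l₂) <
      (l₁ * (Real.tan β / Real.tan α / 2)) * (l₂ * (Real.tan α / Real.tan β / 2)) :=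
    mul_lt_mul'' (by linarith) (by linarith) (by linarith) (by linarith)
  have m2 : (cStar l₁ l₂ - l₁) * (cStar l₁ l₂ - l₂) ≤ (c - l₁) * (c - l₂) :=
    mul_le_mul (by linarith) (by linarith) (by linarith) (by linarith)
  have e : (l₁ * (Real.tan β / Real.tan α / 2)) * (l₂ * (Real.tan α / Real.tan β / 2)) =
      l₁ * l₂ / 4 := by
    field_simp
    norm_num
  linarith [cStar_mul l₁ l₂]

/-- The same elimination with the lower bounds, applied to `c / k` where `k = cos² (2 (α + β))`. -/
theorem IsConfig.mul_cStar_le (h : IsConfig l₁ l₂ α β c) (hl₁ : 0 < l₁) (hl₂ : 0 < l₂)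
    (hs : α + β < Real.pi / 4) : Real.cos (2 * (α + β)) ^ 2 * cStar l₁ l₂ ≤ c := by
  have hp := h.tan_pos
  have hq := h.symm.tan_pos
  have hα := h.left_pos
  have hβ := h.right_pos
  have g1 := TwoBisectors.lt_cStar hl₁ hl₂
  have g2 := TwoBisectors.lt_cStar hl₂ hl₁
  rw [cStar_comm] at g2
  have hk : 0 < Real.cos (2 * (α + β)) :=
    Real.cos_pos_of_mem_Ioo ⟨by linarith [Real.pi_pos], by linarith⟩
  have u1 := h.mul_le_side hl₁ hs.le
  have u2 := h.symm.mul_le_side hl₂ (by linarith)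
  rw [add_comm β] at u2
  set k := Real.cos (2 * (α + β)) ^ 2 with hkdef
  have hk2 : 0 < k := by positivity
  rw [← le_div_iff₀' hk2] at u1 u2 ⊢
  by_contra! hlt
  have t1 : 0 < l₁ * (Real.tan β / Real.tan α / 2) := by positivity
  have t2 : 0 < l₂ * (Real.tan α / Real.tan β / 2) := by positivity
  have m1 : (l₁ * (Real.tan β / Real.tan α / 2)) * (l₂ * (Real.tan α / Real.tan β / 2)) ≤
      (c / k - l₁) * (c / k - l₂) :=
    mul_le_mul (by linarith) (by linarith) t2.le (by linarith)
  have m2 : (c / k - l₁) * (c / k - l₂) < (cStar l₁ l₂ - l₁) * (cStar l₁ l₂ - l₂) :=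
    mul_lt_mul'' (by linarith) (by linarith) (by linarith) (by linarith)
  have e : (l₁ * (Real.tan β / Real.tan α / 2)) * (l₂ * (Real.tan α / Real.tan β / 2)) =
      l₁ * l₂ / 4 := by
    field_simp
    norm_num
  linarith [cStar_mul l₁ l₂]

/-! ### The opposite sides, and existence of solutions -/

/-- The side opposite to the first angle, in terms of the half-angles and the common side. -/
noncomputable def oppositeSide (α β c : ℝ) : ℝ := c * Real.sin (2 * α) / Real.sin (2 * (α + β))

theorem IsConfig.sin_two_mul_add_pos (h : IsConfig l₁ l₂ α β c) :
    0 < Real.sin (2 * (α + β)) :=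
  sin_two_mul_pos (by linarith [h.left_pos, h.right_pos]) h.add_lt

theorem IsConfig.oppositeSide_pos (h : IsConfig l₁ l₂ α β c) (hl₁ : 0 < l₁) :
    0 < oppositeSide α β c :=
  div_pos (mul_pos (h.side_pos hl₁) h.sin_left_pos) h.sin_two_mul_add_pos

/-- This is the classical `l_b = 2ac cos (B/2) / (a + c)`, solved for `1/a`. Since `cos β` and `c`
decrease along the curve, so does `1/a`. -/
theorem IsConfig.inv_oppositeSide (h : IsConfig l₁ l₂ α β c) (hl₁ : 0 < l₁) :
    (oppositeSide α β c)⁻¹ = 2 * Real.cos β / l₁ - c⁻¹ := by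
  have hc := h.side_pos hl₁
  have h1 := h.sin_left_pos
  have e : 2 * Real.cos β * Real.sin (2 * α + β) =
      Real.sin (2 * (α + β)) + Real.sin (2 * α) := by
    have e1 := Real.sin_add (2 * α + β) β
    have e2 := Real.sin_sub (2 * α + β) β
    rw [add_sub_cancel_right] at e2
    rw [show 2 * (α + β) = 2 * α + β + β by ring, e1, e2]
    ring
  rw [oppositeSide, inv_div, div_eq_iff (by positivity)]
  have e3 : (2 * Real.cos β / l₁ - c⁻¹) * (c * Real.sin (2 * α)) =
      2 * Real.cos β / l₁ * (c * Real.sin (2 * α)) - Real.sin (2 * α) := by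
    field_simp
  rw [e3, h.left_eq]
  have e4 : 2 * Real.cos β / l₁ * (l₁ * Real.sin (2 * α + β)) =
      2 * Real.cos β * Real.sin (2 * α + β) := by
    field_simp
  rw [e4, e]
  ring

theorem IsConfig.oppositeSide_lt (h : IsConfig l₁ l₂ α β c) (h' : IsConfig l₁ l₂ α' β' c')
    (hl₁ : 0 < l₁) (hl₂ : 0 < l₂) (hα : α < α') (hβ : β < β') :
    oppositeSide α β c < oppositeSide α' β' c' := by
  rw [← inv_lt_inv₀ (h'.oppositeSide_pos hl₁) (h.oppositeSide_pos hl₁), h.inv_oppositeSide hl₁,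
    h'.inv_oppositeSide hl₁]
  have hcos : Real.cos β' < Real.cos β :=
    Real.cos_lt_cos_of_nonneg_of_le_pi_div_two h.right_pos.le h'.symm.left_lt.le hβ
  have hc := (inv_lt_inv₀ (h.side_pos hl₁) (h'.side_pos hl₁)).2 (h.side_lt h' hl₁ hl₂ hα hβ)
  have : 2 * Real.cos β' / l₁ < 2 * Real.cos β / l₁ := by gcongr
  linarith

theorem exists_isConfig (hl₁ : 0 < l₁) (hl₂ : 0 < l₂) {s : ℝ} (hs : s ∈ Set.Ioo 0 (Real.pi / 2)) :
    ∃ α β c : ℝ, IsConfig l₁ l₂ α β c ∧ α + β = s := by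
  -- The equation `bisectorRatio α (s - α) = l₁ / l₂` with denominators cleared, so that `f` is
  -- defined and of opposite signs at the degenerate ends `α = 0` and `α = s`.
  let f : ℝ → ℝ := fun α => l₂ * Real.sin (2 * α) * Real.sin (2 * (s - α) + α) -
    l₁ * Real.sin (2 * (s - α)) * Real.sin (2 * α + (s - α))
  have hsin : 0 < Real.sin s := Real.sin_pos_of_pos_of_lt_pi hs.1 (by linarith [hs.2, Real.pi_pos])
  have hsin2 := sin_two_mul_pos hs.1 hs.2
  have h0 : f 0 < 0 := by
    have : 0 < l₁ * Real.sin (2 * s) * Real.sin s := by positivity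
    simpa [f] using this
  have h1 : 0 < f s := by
    have : 0 < l₂ * Real.sin (2 * s) * Real.sin s := by positivity
    simpa [f] using this
  obtain ⟨α, hα, hf⟩ := intermediate_value_Ioo hs.1.le
    (show ContinuousOn f (Set.Icc 0 s) by fun_prop) ⟨h0, h1⟩
  have hβ : 0 < s - α := by linarith [hα.2]
  have hsα := sin_two_mul_pos hα.1 (by linarith [hα.2, hs.2])
  refine ⟨α, s - α, l₁ * Real.sin (2 * α + (s - α)) / Real.sin (2 * α),
    ⟨hα.1, hβ, by linarith [hs.2], by field_simp, ?_⟩, by ring⟩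
  rw [div_mul_eq_mul_div, div_eq_iff hsα.ne']
  simp only [f] at hf
  linarith

end Config
end TwoBisectors

namespace TwoBisectors

open Filter Topology

/-! ### The one-parameter family of triangles: monotonicity, limits, images -/

section Curve

/-- The triangles with bisectors `l₁` and `l₂`, parametrized by `s = (A + B) / 2`. -/
def IsCurve (l₁ l₂ : ℝ) (α β c : ℝ → ℝ) : Prop :=
  ∀ s ∈ Set.Ioo 0 (Real.pi / 2), IsConfig l₁ l₂ (α s) (β s) (c s) ∧ α s + β s = s

theorem exists_isCurve {l₁ l₂ : ℝ} (hl₁ : 0 < l₁) (hl₂ : 0 < l₂) :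
    ∃ α β c : ℝ → ℝ, IsCurve l₁ l₂ α β c := by
  have h : ∀ s : ℝ, ∃ α β c : ℝ, s ∈ Set.Ioo 0 (Real.pi / 2) →
      IsConfig l₁ l₂ α β c ∧ α + β = s := fun s => by
    by_cases hs : s ∈ Set.Ioo 0 (Real.pi / 2)
    · obtain ⟨α, β, c, h⟩ := exists_isConfig hl₁ hl₂ hs
      exact ⟨α, β, c, fun _ => h⟩
    · exact ⟨0, 0, 0, fun h => absurd h hs⟩
  choose α β c h using h
  exact ⟨α, β, c, h⟩

theorem arctan_div_add_arctan_div {l₁ l₂ : ℝ} (hl₁ : 0 < l₁) (hl₂ : 0 < l₂) :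
    Real.arctan (l₁ / l₂) + Real.arctan (l₂ / l₁) = Real.pi / 2 := by
  rw [← inv_div l₁ l₂, Real.arctan_inv_of_pos (by positivity)]
  ring

instance neBot_nhdsWithin_left : NeBot (𝓝[Set.Ioo 0 (Real.pi / 2)] (0 : ℝ)) :=
  left_nhdsWithin_Ioo_neBot (by positivity)

instance neBot_nhdsWithin_right : NeBot (𝓝[Set.Ioo 0 (Real.pi / 2)] (Real.pi / 2)) :=
  right_nhdsWithin_Ioo_neBot (by positivity)

theorem lt_of_strictMonoOn_of_tendsto {f : ℝ → ℝ} {u v l x : ℝ}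
    (hf : StrictMonoOn f (Set.Ioo u v)) (ht : Tendsto f (𝓝[Set.Ioo u v] u) (𝓝 l))
    (hx : x ∈ Set.Ioo u v) : l < f x := by
  obtain ⟨y, huy, hyx⟩ := exists_between hx.1
  have hy : y ∈ Set.Ioo u v := ⟨huy, hyx.trans hx.2⟩
  have : NeBot (𝓝[Set.Ioo u v] u) := left_nhdsWithin_Ioo_neBot (hx.1.trans hx.2)
  refine lt_of_le_of_lt (le_of_tendsto ht ?_) (hf hy hx hyx)
  filter_upwards [self_mem_nhdsWithin, mem_nhdsWithin_of_mem_nhds (Iio_mem_nhds huy)] with z hz hzy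
  exact (hf hz hy hzy).le

theorem gt_of_strictAntiOn_of_tendsto {f : ℝ → ℝ} {u v l x : ℝ}
    (hf : StrictAntiOn f (Set.Ioo u v)) (ht : Tendsto f (𝓝[Set.Ioo u v] v) (𝓝 l))
    (hx : x ∈ Set.Ioo u v) : l < f x := by
  obtain ⟨y, hxy, hyv⟩ := exists_between hx.2
  have hy : y ∈ Set.Ioo u v := ⟨hx.1.trans hxy, hyv⟩
  have : NeBot (𝓝[Set.Ioo u v] v) := right_nhdsWithin_Ioo_neBot (hx.1.trans hx.2)
  refine lt_of_le_of_lt (le_of_tendsto ht ?_) (hf hx hy hxy)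
  filter_upwards [self_mem_nhdsWithin, mem_nhdsWithin_of_mem_nhds (Ioi_mem_nhds hyv)] with z hz hzy
  exact (hf hy hz hzy).le

namespace IsCurve

variable {l₁ l₂ : ℝ} {α β c : ℝ → ℝ}

theorem symm (h : IsCurve l₁ l₂ α β c) : IsCurve l₂ l₁ β α c := fun s hs =>
  ⟨(h s hs).1.symm, by rw [add_comm]; exact (h s hs).2⟩

theorem strictMonoOn (h : IsCurve l₁ l₂ α β c) (hl₁ : 0 < l₁) (hl₂ : 0 < l₂) :
    StrictMonoOn α (Set.Ioo 0 (Real.pi / 2)) := by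
  intro s hs t ht hst
  obtain ⟨h1, e1⟩ := h s hs
  obtain ⟨h2, e2⟩ := h t ht
  by_contra! hle
  have := h2.eq_of_le_of_le h1 hl₁ hl₂ hle (by linarith)
  linarith

theorem strictAntiOn_side (h : IsCurve l₁ l₂ α β c) (hl₁ : 0 < l₁) (hl₂ : 0 < l₂) :
    StrictAntiOn c (Set.Ioo 0 (Real.pi / 2)) := fun s hs t ht hst =>
  (h s hs).1.side_lt (h t ht).1 hl₁ hl₂ (h.strictMonoOn hl₁ hl₂ hs ht hst)
    (h.symm.strictMonoOn hl₂ hl₁ hs ht hst)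

theorem strictMonoOn_oppositeSide (h : IsCurve l₁ l₂ α β c) (hl₁ : 0 < l₁) (hl₂ : 0 < l₂) :
    StrictMonoOn (fun s => oppositeSide (α s) (β s) (c s)) (Set.Ioo 0 (Real.pi / 2)) :=
  fun s hs t ht hst =>
    (h s hs).1.oppositeSide_lt (h t ht).1 hl₁ hl₂ (h.strictMonoOn hl₁ hl₂ hs ht hst)
      (h.symm.strictMonoOn hl₂ hl₁ hs ht hst)

/-- Both half-angles increase and their sum is `s`, so each is 1-Lipschitz. -/
theorem continuousOn (h : IsCurve l₁ l₂ α β c) (hl₁ : 0 < l₁) (hl₂ : 0 < l₂) :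
    ContinuousOn α (Set.Ioo 0 (Real.pi / 2)) := by
  have key : ∀ s ∈ Set.Ioo 0 (Real.pi / 2), ∀ t ∈ Set.Ioo 0 (Real.pi / 2), s ≤ t →
      |α s - α t| ≤ |s - t| := by
    intro s hs t ht hst
    have m1 := (h.strictMonoOn hl₁ hl₂).monotoneOn hs ht hst
    have m2 := (h.symm.strictMonoOn hl₂ hl₁).monotoneOn hs ht hst
    have e1 := (h s hs).2
    have e2 := (h t ht).2
    rw [abs_of_nonpos (by linarith), abs_of_nonpos (by linarith)]
    linarith
  have hlip : LipschitzOnWith 1 α (Set.Ioo 0 (Real.pi / 2)) := by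
    refine LipschitzOnWith.of_dist_le_mul fun s hs t ht => ?_
    rw [Real.dist_eq, Real.dist_eq, NNReal.coe_one, one_mul]
    rcases le_total s t with hst | hst
    · exact key s hs t ht hst
    · rw [abs_sub_comm, abs_sub_comm s]
      exact key t ht s hs hst
  exact hlip.continuousOn

theorem continuousOn_side (h : IsCurve l₁ l₂ α β c) (hl₁ : 0 < l₁) (hl₂ : 0 < l₂) :
    ContinuousOn c (Set.Ioo 0 (Real.pi / 2)) := by
  have hα := h.continuousOn hl₁ hl₂
  have hβ := h.symm.continuousOn hl₂ hl₁
  have : ContinuousOn (fun s => l₁ * Real.sin (2 * α s + β s) / Real.sin (2 * α s))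
      (Set.Ioo 0 (Real.pi / 2)) :=
    ContinuousOn.div (by fun_prop) (by fun_prop) fun s hs => (h s hs).1.sin_left_pos.ne'
  exact this.congr fun s hs => (h s hs).1.side_eq

theorem continuousOn_oppositeSide (h : IsCurve l₁ l₂ α β c) (hl₁ : 0 < l₁) (hl₂ : 0 < l₂) :
    ContinuousOn (fun s => oppositeSide (α s) (β s) (c s)) (Set.Ioo 0 (Real.pi / 2)) := by
  have hα := h.continuousOn hl₁ hl₂
  have hβ := h.symm.continuousOn hl₂ hl₁
  have hc := h.continuousOn_side hl₁ hl₂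
  exact ContinuousOn.div (by fun_prop) (by fun_prop) fun s hs => (h s hs).1.sin_two_mul_add_pos.ne'

theorem tendsto_zero (h : IsCurve l₁ l₂ α β c) :
    Tendsto α (𝓝[Set.Ioo 0 (Real.pi / 2)] 0) (𝓝 0) := by
  have hid : Tendsto (fun s : ℝ => s) (𝓝[Set.Ioo 0 (Real.pi / 2)] 0) (𝓝 0) :=
    tendsto_id.mono_left nhdsWithin_le_nhds
  refine tendsto_of_tendsto_of_tendsto_of_le_of_le' tendsto_const_nhds hid ?_ ?_
  · filter_upwards [self_mem_nhdsWithin] with s hs using (h s hs).1.left_pos.le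
  · filter_upwards [self_mem_nhdsWithin] with s hs
    linarith [(h s hs).1.right_pos, (h s hs).2]

/-- A squeeze: the bound on `α` is the limit itself, and the bound on `β = s - α` yields `α > s -
arctan (l₂ / l₁)`. -/
theorem tendsto_arctan (h : IsCurve l₁ l₂ α β c) (hl₁ : 0 < l₁) (hl₂ : 0 < l₂) :
    Tendsto α (𝓝[Set.Ioo 0 (Real.pi / 2)] (Real.pi / 2)) (𝓝 (Real.arctan (l₁ / l₂))) := by
  have hlow : Tendsto (fun s : ℝ => s - Real.arctan (l₂ / l₁))
      (𝓝[Set.Ioo 0 (Real.pi / 2)] (Real.pi / 2)) (𝓝 (Real.arctan (l₁ / l₂))) := by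
    have e := eq_sub_of_add_eq (arctan_div_add_arctan_div hl₁ hl₂)
    rw [e]
    exact (tendsto_id.mono_left nhdsWithin_le_nhds).sub_const _
  refine tendsto_of_tendsto_of_tendsto_of_le_of_le' hlow tendsto_const_nhds ?_ ?_
  · filter_upwards [self_mem_nhdsWithin] with s hs
    linarith [(h s hs).1.symm.left_lt_arctan hl₂ hl₁, (h s hs).2]
  · filter_upwards [self_mem_nhdsWithin] with s hs using ((h s hs).1.left_lt_arctan hl₁ hl₂).le

theorem tendsto_cStar (h : IsCurve l₁ l₂ α β c) (hl₁ : 0 < l₁) (hl₂ : 0 < l₂) :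
    Tendsto c (𝓝[Set.Ioo 0 (Real.pi / 2)] 0) (𝓝 (cStar l₁ l₂)) := by
  have hlow : Tendsto (fun s : ℝ => Real.cos (2 * s) ^ 2 * cStar l₁ l₂)
      (𝓝[Set.Ioo 0 (Real.pi / 2)] 0) (𝓝 (cStar l₁ l₂)) := by
    have : Continuous fun s : ℝ => Real.cos (2 * s) ^ 2 * cStar l₁ l₂ := by fun_prop
    have := (this.tendsto 0).mono_left (nhdsWithin_le_nhds (s := Set.Ioo 0 (Real.pi / 2)))
    simpa using this
  refine tendsto_of_tendsto_of_tendsto_of_le_of_le' hlow tendsto_const_nhds ?_ ?_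
  · filter_upwards [self_mem_nhdsWithin, mem_nhdsWithin_of_mem_nhds
      (Iio_mem_nhds (show (0 : ℝ) < Real.pi / 4 by positivity))] with s hs hs4
    obtain ⟨h1, e⟩ := h s hs
    have := h1.mul_cStar_le hl₁ hl₂ (by rw [e]; exact hs4)
    rwa [e] at this
  · filter_upwards [self_mem_nhdsWithin] with s hs using ((h s hs).1.lt_cStar hl₁ hl₂).le

theorem tendsto_cStarStar (h : IsCurve l₁ l₂ α β c) (hl₁ : 0 < l₁) (hl₂ : 0 < l₂) :
    Tendsto c (𝓝[Set.Ioo 0 (Real.pi / 2)] (Real.pi / 2)) (𝓝 (cStarStar l₁ l₂)) := by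
  have hα := h.tendsto_arctan hl₁ hl₂
  have hβ := h.symm.tendsto_arctan hl₂ hl₁
  have hsum := arctan_div_add_arctan_div hl₁ hl₂
  have hpos : 0 < Real.arctan (l₁ / l₂) := Real.arctan_pos.2 (by positivity)
  have hlt := Real.arctan_lt_pi_div_two (l₁ / l₂)
  have hs := sin_two_mul_pos hpos hlt
  have ht : Tendsto (fun s => l₁ * Real.sin (2 * α s + β s) / Real.sin (2 * α s))
      (𝓝[Set.Ioo 0 (Real.pi / 2)] (Real.pi / 2))
      (𝓝 (l₁ * Real.sin (2 * Real.arctan (l₁ / l₂) + Real.arctan (l₂ / l₁)) /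
        Real.sin (2 * Real.arctan (l₁ / l₂)))) := by
    refine Tendsto.div (Tendsto.const_mul _ ?_) ?_ hs.ne'
    · exact (Real.continuous_sin.tendsto _).comp ((hα.const_mul 2).add hβ)
    · exact (Real.continuous_sin.tendsto _).comp (hα.const_mul 2)
  have e : l₁ * Real.sin (2 * Real.arctan (l₁ / l₂) + Real.arctan (l₂ / l₁)) /
      Real.sin (2 * Real.arctan (l₁ / l₂)) = cStarStar l₁ l₂ := by
    -- The limiting half-angles are complementary, which reduces the side to `l₁ / (2 sin α)`.
    have e1 : 2 * Real.arctan (l₁ / l₂) + Real.arctan (l₂ / l₁) =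
      Real.arctan (l₁ / l₂) + Real.pi / 2 := by linarith
    have e2 : Real.sqrt (1 + (l₁ / l₂) ^ 2) = Real.sqrt (l₁ ^ 2 + l₂ ^ 2) / l₂ := by
      rw [show 1 + (l₁ / l₂) ^ 2 = (l₁ ^ 2 + l₂ ^ 2) / l₂ ^ 2 by field_simp; ring,
        Real.sqrt_div (by positivity), Real.sqrt_sq hl₂.le]
    have hcos := Real.cos_arctan_pos (l₁ / l₂)
    have hr : 0 < Real.sqrt (l₁ ^ 2 + l₂ ^ 2) := by positivity
    rw [e1, Real.sin_add_pi_div_two, Real.sin_two_mul, mul_div_mul_right _ _ hcos.ne',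
      Real.sin_arctan, e2, cStarStar]
    field_simp
  rw [← e]
  refine ht.congr' ?_
  filter_upwards [self_mem_nhdsWithin] with s hs using (h s hs).1.side_eq.symm

theorem tendsto_oppositeSide_aStar (h : IsCurve l₁ l₂ α β c) (hl₁ : 0 < l₁) (hl₂ : 0 < l₂) :
    Tendsto (fun s => oppositeSide (α s) (β s) (c s)) (𝓝[Set.Ioo 0 (Real.pi / 2)] 0)
      (𝓝 (aStar l₁ l₂)) := by
  have hβ := h.symm.tendsto_zero
  have hc := h.tendsto_cStar hl₁ hl₂
  have hlt := lt_cStar hl₁ hl₂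
  have hpos : 0 < cStar l₁ l₂ := hl₁.trans hlt
  have hden : 0 < 2 * cStar l₁ l₂ - l₁ := by linarith
  have hcos : Tendsto (fun s => Real.cos (β s)) (𝓝[Set.Ioo 0 (Real.pi / 2)] 0) (𝓝 1) := by
    have := (Real.continuous_cos.tendsto 0).comp hβ
    rwa [Real.cos_zero] at this
  have ht : Tendsto (fun s => 2 * Real.cos (β s) / l₁ - (c s)⁻¹)
      (𝓝[Set.Ioo 0 (Real.pi / 2)] 0) (𝓝 (2 * 1 / l₁ - (cStar l₁ l₂)⁻¹)) :=
    ((hcos.const_mul 2).div_const l₁).sub (hc.inv₀ hpos.ne')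
  have e : 2 * 1 / l₁ - (cStar l₁ l₂)⁻¹ = (aStar l₁ l₂)⁻¹ := by
    rw [aStar, inv_div]
    field_simp
  have hne : (aStar l₁ l₂)⁻¹ ≠ 0 := by
    rw [← e]
    have : 2 * 1 / l₁ - (cStar l₁ l₂)⁻¹ = (2 * cStar l₁ l₂ - l₁) / (l₁ * cStar l₁ l₂) := by
      field_simp
    rw [this]
    positivity
  rw [e] at ht
  have ht' := ht.inv₀ hne
  rw [inv_inv] at ht'
  refine ht'.congr' ?_
  filter_upwards [self_mem_nhdsWithin] with s hs
  rw [← (h s hs).1.inv_oppositeSide hl₁, inv_inv]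

/-- The numerator `c sin 2α` has a positive limit while `sin 2s` tends to `0` from above. -/
theorem tendsto_oppositeSide_atTop (h : IsCurve l₁ l₂ α β c) (hl₁ : 0 < l₁) (hl₂ : 0 < l₂) :
    Tendsto (fun s => oppositeSide (α s) (β s) (c s))
      (𝓝[Set.Ioo 0 (Real.pi / 2)] (Real.pi / 2)) atTop := by
  have hα := h.tendsto_arctan hl₁ hl₂
  have hc := h.tendsto_cStarStar hl₁ hl₂
  have hpos : 0 < Real.arctan (l₁ / l₂) := Real.arctan_pos.2 (by positivity)
  have hs := sin_two_mul_pos hpos (Real.arctan_lt_pi_div_two (l₁ / l₂))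
  have hcpos : 0 < cStarStar l₁ l₂ := by unfold cStarStar; positivity
  have hnum := hc.mul ((Real.continuous_sin.tendsto _).comp (hα.const_mul 2))
  have hden : Tendsto (fun s => Real.sin (2 * (α s + β s)))
      (𝓝[Set.Ioo 0 (Real.pi / 2)] (Real.pi / 2)) (𝓝[>] 0) := by
    refine tendsto_nhdsWithin_iff.2 ⟨?_, ?_⟩
    · have hcont : Continuous fun s : ℝ => Real.sin (2 * s) := by fun_prop
      have ht := (hcont.tendsto (Real.pi / 2)).mono_left
        (nhdsWithin_le_nhds (s := Set.Ioo 0 (Real.pi / 2)))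
      rw [mul_div_cancel₀ _ (two_ne_zero), Real.sin_pi] at ht
      refine ht.congr' ?_
      filter_upwards [self_mem_nhdsWithin] with s hs
      rw [(h s hs).2]
    · filter_upwards [self_mem_nhdsWithin] with s hs using (h s hs).1.sin_two_mul_add_pos
  have := hnum.pos_mul_atTop (mul_pos hcpos hs) (tendsto_inv_nhdsGT_zero.comp hden)
  exact this

theorem image_left (h : IsCurve l₁ l₂ α β c) (hl₁ : 0 < l₁) (hl₂ : 0 < l₂) :
    α '' Set.Ioo 0 (Real.pi / 2) = Set.Ioo 0 (Real.arctan (l₁ / l₂)) := by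
  refine Set.Subset.antisymm ?_ ?_
  · rintro _ ⟨s, hs, rfl⟩
    exact ⟨(h s hs).1.left_pos, (h s hs).1.left_lt_arctan hl₁ hl₂⟩
  · exact isPreconnected_Ioo.intermediate_value_Ioo
      (l₁ := 𝓝[Set.Ioo 0 (Real.pi / 2)] 0)
      (l₂ := 𝓝[Set.Ioo 0 (Real.pi / 2)] (Real.pi / 2)) inf_le_right inf_le_right
      (h.continuousOn hl₁ hl₂) h.tendsto_zero (h.tendsto_arctan hl₁ hl₂)

theorem image_side (h : IsCurve l₁ l₂ α β c) (hl₁ : 0 < l₁) (hl₂ : 0 < l₂) :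
    c '' Set.Ioo 0 (Real.pi / 2) = Set.Ioo (cStarStar l₁ l₂) (cStar l₁ l₂) := by
  refine Set.Subset.antisymm ?_ ?_
  · rintro _ ⟨s, hs, rfl⟩
    exact ⟨gt_of_strictAntiOn_of_tendsto (h.strictAntiOn_side hl₁ hl₂)
      (h.tendsto_cStarStar hl₁ hl₂) hs, (h s hs).1.lt_cStar hl₁ hl₂⟩
  · exact isPreconnected_Ioo.intermediate_value_Ioo
      (l₁ := 𝓝[Set.Ioo 0 (Real.pi / 2)] (Real.pi / 2))
      (l₂ := 𝓝[Set.Ioo 0 (Real.pi / 2)] 0) inf_le_right inf_le_right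
      (h.continuousOn_side hl₁ hl₂) (h.tendsto_cStarStar hl₁ hl₂) (h.tendsto_cStar hl₁ hl₂)

theorem image_oppositeSide (h : IsCurve l₁ l₂ α β c) (hl₁ : 0 < l₁) (hl₂ : 0 < l₂) :
    (fun s => oppositeSide (α s) (β s) (c s)) '' Set.Ioo 0 (Real.pi / 2) =
      Set.Ioi (aStar l₁ l₂) := by
  refine Set.Subset.antisymm ?_ ?_
  · rintro _ ⟨s, hs, rfl⟩
    exact lt_of_strictMonoOn_of_tendsto (f := fun s => oppositeSide (α s) (β s) (c s))
      (h.strictMonoOn_oppositeSide hl₁ hl₂)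
      (h.tendsto_oppositeSide_aStar hl₁ hl₂) hs
  · exact isPreconnected_Ioo.intermediate_value_Ioi
      (l₁ := 𝓝[Set.Ioo 0 (Real.pi / 2)] 0)
      (l₂ := 𝓝[Set.Ioo 0 (Real.pi / 2)] (Real.pi / 2)) inf_le_right inf_le_right
      (h.continuousOn_oppositeSide hl₁ hl₂) (h.tendsto_oppositeSide_aStar hl₁ hl₂)
      (h.tendsto_oppositeSide_atTop hl₁ hl₂)

/-- A triangle with the given bisectors is the member of the curve with parameter
`(A + B) / 2`. -/
theorem eq_of_hasBisectors (h : IsCurve l₁ l₂ α β c) (hl₁ : 0 < l₁) (hl₂ : 0 < l₂) {T : Tri}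
    (hT : HasBisectors T l₂ l₁) :
    ∃ s ∈ Set.Ioo 0 (Real.pi / 2), angleA T = 2 * α s ∧ angleB T = 2 * β s ∧ sideC T = c s := by
  have hT' := (hasBisectors_iff T l₁ l₂).1 hT
  have hs : angleA T / 2 + angleB T / 2 ∈ Set.Ioo 0 (Real.pi / 2) :=
    ⟨by linarith [hT'.left_pos, hT'.right_pos], hT'.add_lt⟩
  refine ⟨_, hs, ?_⟩
  obtain ⟨h1, e⟩ := h _ hs
  have key : angleA T / 2 = α (angleA T / 2 + angleB T / 2) ∧
      angleB T / 2 = β (angleA T / 2 + angleB T / 2) := by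
    rcases le_total (angleA T / 2) (α (angleA T / 2 + angleB T / 2)) with hle | hle
    · exact hT'.eq_of_le_of_le h1 hl₁ hl₂ hle (by linarith)
    · have := h1.eq_of_le_of_le hT' hl₁ hl₂ hle (by linarith)
      exact ⟨this.1.symm, this.2.symm⟩
  refine ⟨by linarith [key.1], by linarith [key.2], ?_⟩
  rw [hT'.side_eq, h1.side_eq, ← key.1, ← key.2]

theorem exists_triangle (h : IsCurve l₁ l₂ α β c) (hl₁ : 0 < l₁) {s : ℝ}
    (hs : s ∈ Set.Ioo 0 (Real.pi / 2)) : ∃ T : Tri, HasBisectors T l₂ l₁ ∧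
      angleA T = 2 * α s ∧ angleB T = 2 * β s ∧ sideC T = c s := by
  obtain ⟨h1, e⟩ := h s hs
  obtain ⟨T, hA, hB, hc⟩ := TwoBisectors.exists_triangle (A := 2 * α s) (B := 2 * β s)
    (by linarith [h1.left_pos]) (by linarith [h1.right_pos]) (by linarith [h1.add_lt])
    (h1.side_pos hl₁)
  refine ⟨T, ?_, hA, hB, hc⟩
  rw [hasBisectors_iff, hA, hB, hc, mul_div_cancel_left₀ _ two_ne_zero,
    mul_div_cancel_left₀ _ two_ne_zero]
  exact h1

/-- Reduces each of the six claims to injectivity and the image of one function of `s`. -/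
theorem uniqueExactlyOn (h : IsCurve l₁ l₂ α β c) (hl₁ : 0 < l₁) (hl₂ : 0 < l₂) {elt : Tri → ℝ}
    {e : ℝ → ℝ} {S : Set ℝ}
    (helt : ∀ T : Tri, ∀ s ∈ Set.Ioo 0 (Real.pi / 2), angleA T = 2 * α s → angleB T = 2 * β s →
      sideC T = c s → elt T = e s)
    (hinj : Set.InjOn e (Set.Ioo 0 (Real.pi / 2))) (himg : e '' Set.Ioo 0 (Real.pi / 2) = S) :
    UniqueExactlyOn l₂ l₁ elt S := by
  subst himg
  intro x
  constructor
  · rintro ⟨s, hs, rfl⟩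
    obtain ⟨T, hT, hA, hB, hc⟩ := h.exists_triangle hl₁ hs
    refine ⟨T, ⟨hT, helt T s hs hA hB hc⟩, ?_⟩
    rintro T' ⟨hT', hx⟩
    obtain ⟨s', hs', hA', hB', hc'⟩ := h.eq_of_hasBisectors hl₁ hl₂ hT'
    have hss : s' = s := hinj hs' hs (by rw [← hx, helt T' s' hs' hA' hB' hc'])
    subst hss
    exact congruent_of_angle_side_angle (hA'.trans hA.symm) (hc'.trans hc.symm)
      (hB'.trans hB.symm)
  · rintro hx ⟨T, hT, rfl⟩
    obtain ⟨s, hs, hA, hB, hc⟩ := h.eq_of_hasBisectors hl₁ hl₂ hT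
    exact hx ⟨s, hs, (helt T s hs hA hB hc).symm⟩

end IsCurve

theorem image_const_mul_Ioo {f : ℝ → ℝ} {s : Set ℝ} {m : ℝ} (h : f '' s = Set.Ioo 0 m) :
    (fun x => 2 * f x) '' s = Set.Ioo 0 (2 * m) := by
  rw [← Set.image_image (fun y => 2 * y) f, h, Set.image_mul_left_Ioo two_pos, mul_zero]

end Curve

end TwoBisectors

/-! ### The six elements -/

theorem mainTheorem2 (l₁ l₂ : ℝ) (hl₂ : 0 < l₂) (hl : l₂ ≤ l₁) :
    TwoBisectors.UniqueExactlyOn l₂ l₁ TwoBisectors.angleA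
        (Set.Ioo 0 (TwoBisectors.maxA l₁ l₂)) ∧
      TwoBisectors.UniqueExactlyOn l₂ l₁ TwoBisectors.angleB
        (Set.Ioo 0 (TwoBisectors.maxB l₁ l₂)) ∧
      TwoBisectors.UniqueExactlyOn l₂ l₁ TwoBisectors.angleC (Set.Ioo 0 Real.pi) ∧
      TwoBisectors.UniqueExactlyOn l₂ l₁ TwoBisectors.sideA
        (Set.Ioi (TwoBisectors.aStar l₁ l₂)) ∧
      TwoBisectors.UniqueExactlyOn l₂ l₁ TwoBisectors.sideB
        (Set.Ioi (TwoBisectors.bStar l₁ l₂)) ∧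
      TwoBisectors.UniqueExactlyOn l₂ l₁ TwoBisectors.sideC
        (Set.Ioo (TwoBisectors.cStarStar l₁ l₂) (TwoBisectors.cStar l₁ l₂)) := by
  have hl₁ : 0 < l₁ := hl₂.trans_le hl
  obtain ⟨α, β, c, h⟩ := TwoBisectors.exists_isCurve hl₁ hl₂
  have hα := h.strictMonoOn hl₁ hl₂
  have hβ := h.symm.strictMonoOn hl₂ hl₁
  have hsum := TwoBisectors.arctan_div_add_arctan_div hl₁ hl₂
  refine ⟨?_, ?_, ?_, ?_, ?_, ?_⟩
  · refine h.uniqueExactlyOn hl₁ hl₂ (e := fun s => 2 * α s) (fun T s _ hA _ _ => hA)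
      (fun s hs t ht hst => hα.injOn hs ht (by linarith [show 2 * α s = 2 * α t from hst])) ?_
    rw [TwoBisectors.image_const_mul_Ioo (h.image_left hl₁ hl₂), TwoBisectors.maxA,
      TwoBisectors.maxB]
    congr 1
    linarith
  · exact h.uniqueExactlyOn hl₁ hl₂ (e := fun s => 2 * β s) (fun T s _ _ hB _ => hB)
      (fun s hs t ht hst => hβ.injOn hs ht (by linarith [show 2 * β s = 2 * β t from hst]))
      (TwoBisectors.image_const_mul_Ioo (h.symm.image_left hl₂ hl₁))
  · refine h.uniqueExactlyOn hl₁ hl₂ (e := fun s => Real.pi - 2 * s) (fun T s hs hA hB _ => ?_)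
      (fun s _ t _ hst => by linarith [show Real.pi - 2 * s = Real.pi - 2 * t from hst]) ?_
    · linarith [TwoBisectors.angleA_add_angleB_add_angleC T, (h s hs).2]
    · ext x
      constructor
      · rintro ⟨s, hs, rfl⟩
        exact ⟨by linarith [hs.2], by linarith [hs.1]⟩
      · intro hx
        exact ⟨(Real.pi - x) / 2, ⟨by linarith [hx.2], by linarith [hx.1]⟩, by ring⟩
  · refine h.uniqueExactlyOn hl₁ hl₂ (fun T s hs hA hB hc => ?_)
      (h.strictMonoOn_oppositeSide hl₁ hl₂).injOn (h.image_oppositeSide hl₁ hl₂)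
    have := TwoBisectors.sideA_mul_sin T
    rw [hA, hB, hc, ← mul_add] at this
    exact eq_div_of_mul_eq (h s hs).1.sin_two_mul_add_pos.ne' this
  · have himg := h.symm.image_oppositeSide hl₂ hl₁
    -- Exchanging `A` and `B` turns the limit of `a` into that of `b`, because `c*` is symmetric in
    -- `l₁` and `l₂`.
    rw [TwoBisectors.aStar, TwoBisectors.cStar_comm] at himg
    refine h.uniqueExactlyOn hl₁ hl₂ (fun T s hs hA hB hc => ?_)
      (h.symm.strictMonoOn_oppositeSide hl₂ hl₁).injOn himg
    have := TwoBisectors.sideB_mul_sin T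
    rw [hA, hB, hc, ← mul_add, add_comm (α s)] at this
    exact eq_div_of_mul_eq (h.symm s hs).1.sin_two_mul_add_pos.ne' this
  · exact h.uniqueExactlyOn hl₁ hl₂ (fun T s _ _ _ hc => hc)
      (h.strictAntiOn_side hl₁ hl₂).injOn (h.image_side hl₁ hl₂)
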